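/- Notation. Let $1\le k<n$ be integers and $s\in(1/2,1)$; write $x\in\mathbb R^n$ as $x=(y,z)$ with $y\in\mathbb R^k$, $z\in\mathbb R^{n-k}$. Let $\mathcal K_k^s$ be the set of measurable $K:\mathbb R^n\to[0,\infty)$ such that for all $z\in\mathbb R^{n-k}$ and all $r>0$, $$\mathcal H^k\big(\{y\in\mathbb R^k: K(y,z)>r^{-n-2s}\}\big)=\begin{cases}\mathcal H^k\big(B_{(r^2-|z|^2)^{1/2}}\big)&\text{if }|z|<r,\\ 0&\text{if }|z|\ge r,\end{cases}$$ where $B_\rho$ is the ball of radius $\rho$ in $\mathbb R^k$ and $\mathcal H^k$ is $k$-dimensional (Lebesgue) measure. For a convex differentiable $u:\mathbb R^n\to\mathbb R$ and $x\in\mathbb R^n$, $t>0$, put $$\mathcal F_k^su(x)=c_{n,s}\inf_{K\in\mathcal K_k^s}\int_{\mathbb R^n}\big(u(x+v)-u(x)-v\cdot\nabla u(x)\big)K(v)\,dv\in[0,\infty],$$ $$D_xu(t)=\{w\in\mathbb R^n:u(w)-u(x)-(w-x)\cdot\nabla u(x)\le t\},$$ where $c_{n,s}=\frac{4^s s\,\Gamma(n/2+s)}{\pi^{n/2}\Gamma(1-s)}$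 is the constant of the fractional Laplacian. We write $u\in C^{1,1}(\mathbb R^n)$ if $u$ is differentiable and $\nabla u$ is globally Lipschitz, and then $[u]_{C^{1,1}(\mathbb R^n)}$ is the least Lipschitz constant of $\nabla u$. Theorem. Let $s\in(1/2,1)$, $1\le k<n$, and let $u\in C^{1,1}(\mathbb R^n)$ be convex. Fix $x_0\in\mathbb R^n$ and $r_0,\varepsilon>0$. Suppose that $$\Lambda=\sup_{x\in B_{r_0}(x_0)}\operatorname{diam}(D_xu(\varepsilon))<\infty,\qquad M=\sup_{x\in B_{r_0}(x_0)}\mathcal F_k^su(x)<\infty .$$ Then for every $0<r<\min\{r_0/4,\ \Lambda,\ \varepsilon/(8\Lambda)\}$ we have $\mathcal F_k^su\in C^{0,1-s}(\overline{B_r(x_0)})$ and $$[\mathcal F_k^su]_{C^{0,1-s}(\overline{B_r(x_0)})}=\sup_{\substack{x,x'\in\overline{B_r(x_0)}\\ x\ne x'}}\frac{|\mathcal F_k^su(x)-\mathcal F_k^su(x')|}{|x-x'|^{1-s}}\le C_0\,[u]_{C^{1,1}(\mathbb R^n)},$$ for some constant $C_0>0$ depending only on $n$, $k$, $s$, $\varepsilon$,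 $\Lambda$ and $M$. -/

import Mathlib

open scoped NNReal ENNReal
open MeasureTheory

noncomputable section

namespace FracMA

/-- The Euclidean space `ℝⁿ`. -/
abbrev E (n : ℕ) : Type := EuclideanSpace ℝ (Fin n)

/-- The point `x = (y, z) ∈ ℝⁿ` with first `k` coordinates `y ∈ ℝᵏ` and last `n - k` coordinates
`z ∈ ℝⁿ⁻ᵏ`. -/
def join {n k : ℕ} (y : E k) (z : E (n - k)) : E n :=
  WithLp.toLp 2 fun i : Fin n =>
    if h : (i : ℕ) < k then y ⟨i, h⟩ else z ⟨(i : ℕ) - k, by omega⟩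

/-- The family of admissible kernels `K : ℝⁿ → ℝ₊`: measurable functions such that, for all
`z ∈ ℝⁿ⁻ᵏ` and all `r > 0`, the slice `{y ∈ ℝᵏ : K(y,z) > r^(-n-2s)}` has the same `k`-dimensional
measure as the ball of radius `(r² - |z|²)^(1/2)` in `ℝᵏ` if `|z| < r`, and measure zero if
`|z| ≥ r`. -/
def kernels (n k : ℕ) (s : ℝ) : Set (E n → ℝ≥0) :=
  {K | Measurable K ∧ ∀ (z : E (n - k)) (r : ℝ), 0 < r →
    volume {y : E k | r ^ (-(n : ℝ) - 2 * s) < (K (join y z) : ℝ)} =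
      if ‖z‖ < r then volume (Metric.ball (0 : E k) (Real.sqrt (r ^ 2 - ‖z‖ ^ 2))) else 0}

/-- The normalizing constant `c_{n,s} = 4ˢ s Γ(n/2 + s) / (π^{n/2} Γ(1 - s))` of the fractional
Laplacian `Δˢ = -(-Δ)ˢ` on `ℝⁿ`. -/
def cns (n : ℕ) (s : ℝ) : ℝ :=
  (4 : ℝ) ^ s * s * Real.Gamma ((n : ℝ) / 2 + s) /
    (Real.pi ^ ((n : ℝ) / 2) * Real.Gamma (1 - s))

/-- `ũ_x(v) = u(x + v) - u(x) - v · ∇u(x)`. -/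
def dev {n : ℕ} (u : E n → ℝ) (x v : E n) : ℝ :=
  u (x + v) - u x - inner ℝ v (gradient u x)

/-- For a convex function which is differentiable at `x`, `ũ_x` is nonnegative. -/
theorem dev_nonneg {n : ℕ} {u : E n → ℝ} (hu : ConvexOn ℝ Set.univ u) {x : E n}
    (hx : DifferentiableAt ℝ u x) (v : E n) : 0 ≤ dev u x v := by
  have hg : ConvexOn ℝ Set.univ (fun t : ℝ => u (x + t • v)) := by
    have := hu.comp_affineMap (AffineMap.lineMap x (x + v))
    simpa [Function.comp_def, AffineMap.lineMap_apply, add_comm] using this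
  have hd : HasDerivAt (fun t : ℝ => u (x + t • v)) (inner ℝ v (gradient u x)) 0 := by
    have h1 : HasDerivAt (fun t : ℝ => x + t • v) v 0 := by
      simpa using ((hasDerivAt_id (0 : ℝ)).smul_const v).const_add x
    have h2 : HasFDerivAt u (fderiv ℝ u x) (x + (0 : ℝ) • v) := by
      simpa using hx.hasFDerivAt
    have h3 := h2.comp_hasDerivAt (0 : ℝ) h1
    have h4 : fderiv ℝ u x v = inner ℝ v (gradient u x) := by
      rw [real_inner_comm]
      simp [gradient, InnerProductSpace.toDual_symm_apply]
    rw [h4] at h3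
    exact h3
  have h := hg.le_slope_of_hasDerivAt (Set.mem_univ 0) (Set.mem_univ 1) one_pos hd
  simp only [slope_def_field, zero_smul, one_smul, add_zero, sub_zero, div_one] at h
  simp only [dev]
  linarith

/-- The operator `𝓕ₖˢ u(x) = c_{n,s} inf_K ∫ ũ_x(v) K(v) dv`, the infimum being over all admissible
kernels, for a convex differentiable function `u`. The integrand is then nonnegative
(`dev_nonneg`), so that the integrals, which may be infinite for some of the kernels, and their
infimum are elements of `[0, ∞]`. -/
def F {n : ℕ} (k : ℕ) (s : ℝ) (u : E n → ℝ) (x : E n) : ℝ≥0∞ :=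
  ENNReal.ofReal (cns n s) *
    ⨅ K ∈ kernels n k s, ∫⁻ v : E n, ENNReal.ofReal (dev u x v) * (K v : ℝ≥0∞)

/-- The section `D_x u(t) = {w : u(w) - u(x) - (w - x) · ∇u(x) ≤ t}`. -/
def sect {n : ℕ} (u : E n → ℝ) (x : E n) (t : ℝ) : Set (E n) :=
  {w | u w - u x - inner ℝ (w - x) (gradient u x) ≤ t}

/-- `u ∈ C^{1,1}(ℝⁿ)`: `u` is differentiable and its gradient is (globally) Lipschitz. -/
def IsC11 {n : ℕ} (u : E n → ℝ) : Prop :=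
  Differentiable ℝ u ∧ ∃ L : ℝ≥0, LipschitzWith L (gradient u)

/-- The seminorm `[u]_{C^{1,1}(ℝⁿ)}`: the least Lipschitz constant of `∇u` (for
`u ∈ C^{1,1}(ℝⁿ)`). -/
def c11Seminorm {n : ℕ} (u : E n → ℝ) : ℝ≥0 :=
  sInf {L : ℝ≥0 | LipschitzWith L (gradient u)}

end FracMA

end

/-! Let x, x' be at distance h and let L be the C^{1,1} seminorm. Replacing x by x' changes the
deviation `dev u x v` by at most 2Lh|v| (`dev_le_dev_add`). Convexity and a bounded section force
linear growth of the deviation (`norm_le_of_ediam_sect`), so |v| is absorbed: dev u x' ≤ (1 + O(h))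
dev u x + O(h). The additive constant cannot be integrated against a kernel, whose total mass is
infinite; on the high levels of the kernel the quadratic bound of `dev_le_sq` has to replace it.

An admissible kernel need not concentrate near the origin, so the quadratic bound is of no use for
an arbitrary one. But each of its superlevel sets has the slice measures of a ball of some radius r.
The kernel whose superlevel sets are slicewise sublevel sets of the deviation at x' is optimal by
the bathtub principle, and level by level it does at least as well as both the given kernel and the
ball itself (`exists_kernel_le`). The error at a level is therefore O(min(h, (1 + h)r²) rⁿ), and
summing over the levels, with crossover at r = √h, gives h^{1-s} (`lintegral_min_le`).

Sublevel sets of prescribed measure are available in a slice when level sets are null and sublevel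
sets have finite measure. To ensure this, Lh times the strictly convex function `bump` is added to
the deviation at x' before rearranging; this costs no more than the change of base point. Exchanging
x and x' gives the two-sided estimate. -/

noncomputable section

namespace FracMA

/-! ### Bathtub principle, sublevel sets of given measure, layer cake formula. -/

section

/-- The bathtub principle: among the sets of a given finite measure, the sublevel sets of a
function minimize its integral. -/
theorem setLIntegral_le_of_sublevel {α : Type*} [MeasurableSpace α] {μ : Measure α}
    {A B : Set α} (hA : MeasurableSet A) (hB : MeasurableSet B) (hAB : μ B = μ A)
    (hfin : μ A ≠ ∞) {G : α → ℝ≥0∞} (τ : ℝ≥0∞)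
    (hle : ∀ᵐ y ∂μ, y ∈ B → G y ≤ τ) (hge : ∀ᵐ y ∂μ, y ∉ B → τ ≤ G y) :
    ∫⁻ y in B, G y ∂μ ≤ ∫⁻ y in A, G y ∂μ := by
  have hdiff : μ (B \ A) = μ (A \ B) := by
    have h1 := measure_inter_add_sdiff (μ := μ) B hA
    have h2 := measure_inter_add_sdiff (μ := μ) A hB
    rw [Set.inter_comm, hAB, ← h2] at h1
    exact (ENNReal.add_right_inj
      (ne_top_of_le_ne_top hfin (measure_mono Set.inter_subset_left))).1 h1
  have hlow : ∫⁻ y in B \ A, G y ∂μ ≤ τ * μ (B \ A) := by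
    rw [← setLIntegral_const]
    refine setLIntegral_mono_ae (by fun_prop) ?_
    filter_upwards [hle] with y hy hyB using hy hyB.1
  have hup : τ * μ (A \ B) ≤ ∫⁻ y in A \ B, G y ∂μ := by
    rw [← setLIntegral_const]
    refine lintegral_mono_ae ((ae_restrict_iff' (hA.diff hB)).2 ?_)
    filter_upwards [hge] with y hy hyB using hy hyB.2
  rw [← lintegral_inter_add_sdiff G B hA, ← lintegral_inter_add_sdiff G A hB, Set.inter_comm]
  exact add_le_add le_rfl (hlow.trans (hdiff ▸ hup))

/-- If the level sets of `φ` are null, the points of rank less than `c` form, up to a null set,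
a sublevel set of measure `c`. -/
theorem exists_sublevel_ae_eq_rank_lt {α : Type*} [MeasurableSpace α] {μ : Measure α}
    {φ : α → ℝ} (hφ : Measurable φ) (hfin : ∀ t, μ {y | φ y ≤ t} ≠ ∞)
    (hnull : ∀ t, μ {y | φ y = t} = 0) (huniv : μ Set.univ = ∞) (hbdd : ∃ b, ∀ y, b ≤ φ y)
    {c : ℝ≥0∞} (hc : 0 < c) (hc' : c ≠ ∞) :
    ∃ t₀ : ℝ, μ {y | φ y < t₀} = c ∧
      {y | μ {y' | φ y' < φ y} < c} =ᵐ[μ] {y | φ y < t₀} := by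
  set m : ℝ → ℝ≥0∞ := fun t => μ {y | φ y < t} with hm
  have hmono : Monotone m := fun a b hab => measure_mono fun y hy => lt_of_lt_of_le hy hab
  obtain ⟨b, hb⟩ := hbdd
  have hmb : m b = 0 := by
    have : {y | φ y < b} = ∅ := by ext y; simpa using hb y
    simp [hm, this]
  have htop : ∃ T, c < m T := by
    have h1 : Filter.Tendsto (fun N : ℕ => m N) Filter.atTop (nhds (μ (⋃ N : ℕ, {y | φ y < N}))) :=
      tendsto_measure_iUnion_atTop fun i j hij y (hy : φ y < i) =>
        lt_of_lt_of_le hy (by exact_mod_cast hij)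
    have h2 : (⋃ N : ℕ, {y | φ y < N}) = Set.univ := by
      ext y; simpa using exists_nat_gt (φ y)
    rw [h2, huniv] at h1
    obtain ⟨N, hN⟩ := ((tendsto_order.1 h1).1 c (lt_top_iff_ne_top.2 hc')).exists
    exact ⟨N, hN⟩
  obtain ⟨T, hT⟩ := htop
  -- The threshold is the supremum of the levels whose sublevel set is smaller than `c`. Continuity
  -- of the measure from below bounds the open sublevel set by `c`, continuity from above bounds the
  -- closed one below by `c`, and they differ by a null level set.
  set J : Set ℝ := {t | m t < c}
  have hJb : b ∈ J := by simpa [J, hmb] using hc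
  have hJup : BddAbove J := ⟨T, fun t ht => by
    by_contra! h
    exact absurd (hmono h.le) (not_le.2 (lt_trans ht hT))⟩
  set t₀ := sSup J
  have hlt : ∀ t < t₀, m t < c := fun t ht => by
    obtain ⟨t', ht', h⟩ := exists_lt_of_lt_csSup ⟨b, hJb⟩ ht
    exact lt_of_le_of_lt (hmono h.le) ht'
  have hgt : ∀ t, t₀ < t → c ≤ m t := fun t ht => by
    by_contra! h
    exact absurd (le_csSup hJup h) (not_le.2 ht)
  have hle : m t₀ ≤ c := by
    have h1 : Filter.Tendsto (fun N : ℕ => m (t₀ - 1 / ((N : ℝ) + 1))) Filter.atTop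
        (nhds (μ (⋃ N : ℕ, {y | φ y < t₀ - 1 / ((N : ℝ) + 1)}))) :=
      tendsto_measure_iUnion_atTop fun i j hij y (hy : φ y < _) => by
        refine lt_of_lt_of_le hy ?_
        have := Nat.one_div_le_one_div (α := ℝ) hij
        linarith
    have h2 : (⋃ N : ℕ, {y | φ y < t₀ - 1 / ((N : ℝ) + 1)}) = {y | φ y < t₀} := by
      ext y
      simp only [Set.mem_iUnion, Set.mem_ofPred_eq]
      constructor
      · rintro ⟨N, hN⟩
        have : 0 < 1 / ((N : ℝ) + 1) := Nat.one_div_pos_of_nat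
        linarith
      · intro h
        obtain ⟨N, hN⟩ := exists_nat_one_div_lt (sub_pos.2 h)
        exact ⟨N, by linarith⟩
    rw [h2] at h1
    refine le_of_tendsto' h1 fun N => (hlt _ ?_).le
    have : 0 < 1 / ((N : ℝ) + 1) := Nat.one_div_pos_of_nat
    linarith
  have hge : c ≤ μ {y | φ y ≤ t₀} := by
    have h1 : Filter.Tendsto (fun N : ℕ => m (t₀ + 1 / ((N : ℝ) + 1))) Filter.atTop
        (nhds (μ (⋂ N : ℕ, {y | φ y < t₀ + 1 / ((N : ℝ) + 1)}))) := by
      refine tendsto_measure_iInter_atTop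
        (fun i => (measurableSet_lt hφ measurable_const).nullMeasurableSet)
        (fun i j hij y (hy : φ y < _) => ?_)
        ⟨0, ne_top_of_le_ne_top (hfin (t₀ + 1)) (measure_mono fun y (hy : φ y < _) => ?_)⟩
      · refine lt_of_lt_of_le hy ?_
        have := Nat.one_div_le_one_div (α := ℝ) hij
        linarith
      · simpa using hy.le
    have h2 : (⋂ N : ℕ, {y | φ y < t₀ + 1 / ((N : ℝ) + 1)}) = {y | φ y ≤ t₀} := by
      ext y
      simp only [Set.mem_iInter, Set.mem_ofPred_eq]
      constructor
      · intro h
        by_contra! hy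
        obtain ⟨N, hN⟩ := exists_nat_one_div_lt (sub_pos.2 hy)
        have := h N
        linarith
      · intro h N
        have : 0 < 1 / ((N : ℝ) + 1) := Nat.one_div_pos_of_nat
        linarith
    rw [h2] at h1
    refine ge_of_tendsto' h1 fun N => hgt _ ?_
    have : 0 < 1 / ((N : ℝ) + 1) := Nat.one_div_pos_of_nat
    linarith
  have hae : {y | φ y ≤ t₀} =ᵐ[μ] {y | φ y < t₀} := by
    have : ∀ᵐ y ∂μ, φ y ≠ t₀ := by
      rw [ae_iff]; simpa using hnull t₀
    filter_upwards [this] with y hy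
    exact propext ⟨fun h => lt_of_le_of_ne h hy, fun h => le_of_lt h⟩
  refine ⟨t₀, le_antisymm hle (hge.trans (measure_congr hae).le), ?_⟩
  have : ∀ᵐ y ∂μ, φ y ≠ t₀ := by
    rw [ae_iff]; simpa using hnull t₀
  filter_upwards [this] with y hy
  refine propext ⟨fun h => ?_, fun h => hlt _ h⟩
  by_contra hlt'
  have h1 : t₀ < φ y := lt_of_le_of_ne (not_lt.1 hlt') (Ne.symm hy)
  exact absurd h (not_lt.2 (hgt _ h1))

/-- The level sets of a continuous convex function, strictly convex at midpoints, are null. -/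
theorem measure_level_eq_zero {V : Type*} [NormedAddCommGroup V] [NormedSpace ℝ V]
    [FiniteDimensional ℝ V] [MeasurableSpace V] [BorelSpace V] [Nontrivial V] (μ : Measure V)
    [μ.IsAddHaarMeasure] {φ : V → ℝ} (hconv : ConvexOn ℝ Set.univ φ)
    (hmid : ∀ v w, w ≠ 0 → 2 * φ v < φ (v + w) + φ (v - w)) (t : ℝ) :
    μ {y | φ y = t} = 0 := by
  have hC : Convex ℝ {y | φ y ≤ t} := by simpa using hconv.convex_le t
  -- The frontier of a convex set is null. A point of the level set interior to the sublevel set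
  -- would be the midpoint of two points with values at most `t`, against strict midpoint convexity.
  refine measure_mono_null (fun y hy => ?_) (hC.addHaar_frontier μ)
  refine ⟨subset_closure (le_of_eq hy), fun hint => ?_⟩
  obtain ⟨ρ, hρ, hball⟩ := Metric.isOpen_iff.1 isOpen_interior y hint
  obtain ⟨w, hw⟩ := exists_norm_eq V (c := ρ / 2) (by positivity)
  have hw0 : w ≠ 0 := by
    rintro rfl
    rw [norm_zero] at hw
    linarith
  have h1 : φ (y + w) ≤ t := by
    have hb : y + w ∈ Metric.ball y ρ := by simp [hw, hρ]
    have := interior_subset (hball hb)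
    exact this
  have h2 : φ (y - w) ≤ t := by
    have hb : y - w ∈ Metric.ball y ρ := by simp [hw, hρ]
    have := interior_subset (hball hb)
    exact this
  have h3 := hmid y w hw0
  have h4 : φ y = t := hy
  linarith

/-- Layer cake formula in the levels of the kernel. -/
theorem lintegral_mul_eq_lintegral_superlevel {α : Type*} [MeasurableSpace α] {μ : Measure α}
    {G : α → ℝ≥0∞} (hG : Measurable G) {K : α → ℝ≥0} (hK : Measurable K) :
    ∫⁻ v, G v * (K v : ℝ≥0∞) ∂μ =
      ∫⁻ l in Set.Ioi (0 : ℝ), ∫⁻ v in {v | l < (K v : ℝ)}, G v ∂μ := by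
  -- With `G` moved into the measure as a density, this is the usual layer cake formula for `K`
  -- alone.
  have h1 := lintegral_withDensity_eq_lintegral_mul μ hG (g := fun v => (K v : ℝ≥0∞)) (by fun_prop)
  simp only [Pi.mul_apply] at h1
  rw [← h1]
  have h2 := lintegral_eq_lintegral_meas_lt (f := fun v => (K v : ℝ)) (μ.withDensity G)
    (Filter.Eventually.of_forall fun v => (K v).2) (by fun_prop)
  simp only [ENNReal.ofReal_coe_nnreal] at h2
  rw [h2]
  refine lintegral_congr fun l => ?_
  rw [withDensity_apply _ (measurableSet_lt measurable_const (by fun_prop))]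

end

/-! ### The splitting ℝⁿ = ℝᵏ × ℝⁿ⁻ᵏ and slicewise comparison of integrals. -/

section

variable {n k : ℕ}

/-- The splitting of the coordinates into the first `k` and the last `n - k`. -/
def splitEquiv (h : k ≤ n) : Fin k ⊕ Fin (n - k) ≃ Fin n :=
  finSumFinEquiv.trans (finCongr (by omega))

theorem join_splitEquiv_inl (h : k ≤ n) (y : E k) (z : E (n - k)) (i : Fin k) :
    join y z (splitEquiv h (.inl i)) = y i := by
  simp [join, splitEquiv]

theorem join_splitEquiv_inr (h : k ≤ n) (y : E k) (z : E (n - k)) (i : Fin (n - k)) :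
    join y z (splitEquiv h (.inr i)) = z i := by
  simp [join, splitEquiv]

theorem norm_join_sq (h : k ≤ n) (y : E k) (z : E (n - k)) :
    ‖join y z‖ ^ 2 = ‖y‖ ^ 2 + ‖z‖ ^ 2 := by
  rw [EuclideanSpace.norm_sq_eq, EuclideanSpace.norm_sq_eq, EuclideanSpace.norm_sq_eq,
    ← (splitEquiv h).sum_comp, Fintype.sum_sum_type]
  simp [join_splitEquiv_inl, join_splitEquiv_inr]

theorem join_add (y y' : E k) (z z' : E (n - k)) :
    join (y + y') (z + z') = join y z + join y' z' := by
  ext i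
  by_cases h : (i : ℕ) < k <;> simp [join, h]

theorem join_smul (c : ℝ) (y : E k) (z : E (n - k)) :
    join (c • y) (c • z) = c • join y z := by
  ext i
  by_cases h : (i : ℕ) < k <;> simp [join, h]

/-- `join` as a linear isometry. -/
def joinIsometry (h : k ≤ n) : WithLp 2 (E k × E (n - k)) →ₗᵢ[ℝ] E n where
  toFun p := join p.fst p.snd
  map_add' p q := by simpa using join_add p.fst q.fst p.snd q.snd
  map_smul' c p := by simpa using join_smul c p.fst p.snd
  norm_map' p := by
    refine (sq_eq_sq₀ (norm_nonneg _) (norm_nonneg _)).1 ?_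
    rw [WithLp.prod_norm_sq_eq_of_L2]
    exact norm_join_sq h _ _

/-- `join` as an isometric equivalence. -/
def joinEquiv (h : k ≤ n) : WithLp 2 (E k × E (n - k)) ≃ₗᵢ[ℝ] E n :=
  (joinIsometry h).toLinearIsometryEquiv (by
    rw [(WithLp.linearEquiv 2 ℝ (E k × E (n - k))).finrank_eq]
    simp [h])

theorem joinEquiv_apply (h : k ≤ n) (p : WithLp 2 (E k × E (n - k))) :
    joinEquiv h p = join p.fst p.snd := by
  rw [joinEquiv, LinearIsometry.coe_toLinearIsometryEquiv]; rfl

theorem joinEquiv_symm_join (h : k ≤ n) (y : E k) (z : E (n - k)) :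
    (joinEquiv h).symm (join y z) = WithLp.toLp 2 (y, z) := by
  rw [LinearIsometryEquiv.symm_apply_eq]
  exact (joinEquiv_apply h (WithLp.toLp 2 (y, z))).symm

theorem continuous_join (h : k ≤ n) :
    Continuous fun p : E k × E (n - k) => join p.1 p.2 := by
  have : (fun p : E k × E (n - k) => join p.1 p.2) = fun p => joinEquiv h (WithLp.toLp 2 p) := by
    ext1 p
    exact (joinEquiv_apply h _).symm
  rw [this]
  fun_prop

theorem measurePreserving_join (h : k ≤ n) :
    MeasurePreserving (fun p : E k × E (n - k) => join p.1 p.2) := by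
  have : (fun p : E k × E (n - k) => join p.1 p.2) = fun p => joinEquiv h (WithLp.toLp 2 p) := by
    ext1 p
    exact (joinEquiv_apply h _).symm
  rw [this]
  exact (joinEquiv h).measurePreserving.comp (WithLp.volume_preserving_toLp (E k) (E (n - k)))

theorem measurable_join_left (h : k ≤ n) (z : E (n - k)) :
    Measurable fun y : E k => join y z :=
  (continuous_join h).measurable.comp measurable_prodMk_right

/-- Fubini's theorem in the variables `(y, z)`. -/
theorem lintegral_join (h : k ≤ n) {G : E n → ℝ≥0∞} (hG : Measurable G) :
    ∫⁻ v, G v = ∫⁻ z : E (n - k), ∫⁻ y : E k, G (join y z) := by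
  rw [← (measurePreserving_join h).lintegral_comp hG, Measure.volume_eq_prod, lintegral_prod_symm]
  exact (hG.comp (continuous_join h).measurable).aemeasurable

theorem setLIntegral_join (h : k ≤ n) {G : E n → ℝ≥0∞} (hG : Measurable G) {A : Set (E n)}
    (hA : MeasurableSet A) :
    ∫⁻ v in A, G v =
      ∫⁻ z : E (n - k), ∫⁻ y in {y : E k | join y z ∈ A}, G (join y z) := by
  rw [← lintegral_indicator hA, lintegral_join h (hG.indicator hA)]
  refine lintegral_congr fun z => ?_
  exact lintegral_indicator (measurable_join_left h z hA) fun y => G (join y z)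

/-- The measure of the slice at height `z` of the ball of radius `r`. -/
def ballSlice (k : ℕ) {m : ℕ} (r : ℝ) (z : E m) : ℝ≥0∞ :=
  if ‖z‖ < r then volume (Metric.ball (0 : E k) (Real.sqrt (r ^ 2 - ‖z‖ ^ 2))) else 0

theorem ballSlice_ne_top (r : ℝ) (z : E (n - k)) : ballSlice k r z ≠ ∞ := by
  unfold ballSlice
  split_ifs
  · exact measure_ball_lt_top.ne
  · simp

theorem volume_slice_ball (h : k ≤ n) {r : ℝ} (hr : 0 < r) (z : E (n - k)) :
    volume {y : E k | join y z ∈ Metric.ball (0 : E n) r} = ballSlice k r z := by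
  have h1 : {y : E k | join y z ∈ Metric.ball (0 : E n) r} =
      {y : E k | ‖y‖ ^ 2 + ‖z‖ ^ 2 < r ^ 2} := by
    ext y
    rw [Set.mem_ofPred_eq, mem_ball_zero_iff, ← sq_lt_sq₀ (norm_nonneg _) hr.le, norm_join_sq h]
    rfl
  rw [h1, ballSlice]
  split_ifs with hz
  · congr 1
    ext y
    rw [mem_ball_zero_iff, Real.lt_sqrt (norm_nonneg _), lt_sub_iff_add_lt]
    rfl
  · have : {y : E k | ‖y‖ ^ 2 + ‖z‖ ^ 2 < r ^ 2} = ∅ := by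
      ext y
      have : r ^ 2 ≤ ‖z‖ ^ 2 := pow_le_pow_left₀ hr.le (not_lt.1 hz) 2
      simp only [Set.mem_ofPred_eq, Set.mem_empty_iff_false, iff_false, not_lt]
      nlinarith [sq_nonneg ‖y‖]
    rw [this, measure_empty]

/-- A set with the slice measures of a ball has the measure of this ball. -/
theorem volume_eq_of_slices (h : k ≤ n) {A : Set (E n)} (hA : MeasurableSet A) {r : ℝ}
    (hr : 0 < r) (hs : ∀ z : E (n - k), volume {y : E k | join y z ∈ A} = ballSlice k r z) :
    volume A = volume (Metric.ball (0 : E n) r) := by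
  rw [← setLIntegral_one, ← setLIntegral_one, setLIntegral_join h measurable_const hA,
    setLIntegral_join h measurable_const measurableSet_ball]
  refine lintegral_congr fun z => ?_
  rw [setLIntegral_one, setLIntegral_one, hs, volume_slice_ball h hr]

/-- The bathtub principle in each slice. -/
theorem setLIntegral_le_of_slices (h : k ≤ n) {A B : Set (E n)} (hA : MeasurableSet A)
    (hB : MeasurableSet B) {r : ℝ} {g : E n → ℝ} (hg : Measurable g)
    (hsA : ∀ z : E (n - k), volume {y : E k | join y z ∈ A} = ballSlice k r z)
    (hsB : ∀ z : E (n - k), volume {y : E k | join y z ∈ B} = ballSlice k r z)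
    (hsub : ∀ z : E (n - k), ‖z‖ < r → ∃ t₀ : ℝ,
      {y : E k | join y z ∈ B} =ᵐ[volume] {y | g (join y z) < t₀}) :
    ∫⁻ v in B, ENNReal.ofReal (g v) ≤ ∫⁻ v in A, ENNReal.ofReal (g v) := by
  rw [setLIntegral_join h (by fun_prop) hA, setLIntegral_join h (by fun_prop) hB]
  refine lintegral_mono fun z => ?_
  have hmA := measurable_join_left h z hA
  have hmB := measurable_join_left h z hB
  by_cases hz : ‖z‖ < r
  · obtain ⟨t₀, ht₀⟩ := hsub z hz
    refine setLIntegral_le_of_sublevel hmA hmB ((hsB z).trans (hsA z).symm)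
      (hsA z ▸ ballSlice_ne_top r z) (ENNReal.ofReal t₀) ?_ ?_
    · filter_upwards [ht₀.mem_iff] with y hy hyB
      exact ENNReal.ofReal_le_ofReal (le_of_lt (hy.1 hyB))
    · filter_upwards [ht₀.mem_iff] with y hy hyB
      exact ENNReal.ofReal_le_ofReal (not_lt.1 fun hlt => hyB (hy.2 hlt))
  · have h0 : volume {y : E k | join y z ∈ B} = 0 := by rw [hsB z, ballSlice, if_neg hz]
    rw [setLIntegral_measure_zero _ _ h0]
    exact zero_le

end

/-! ### The optimal admissible kernel, built by slicewise rearrangement. -/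

section

variable {n k : ℕ}

/-- The measure of the slice sublevel set of `g` below the value at `v`. -/
def sliceRank (h : k ≤ n) (g : E n → ℝ) (v : E n) : ℝ≥0∞ :=
  volume {y' : E k | g (join y' ((joinEquiv h).symm v).snd) < g v}

theorem measurable_sliceRank (h : k ≤ n) {g : E n → ℝ} (hg : Continuous g) :
    Measurable (sliceRank h g) := by
  have hmeas : MeasurableSet
      {p : E n × E k | g (join p.2 ((joinEquiv h).symm p.1).snd) < g p.1} := by
    refine (isOpen_lt ?_ ?_).measurableSet
    · refine hg.comp ((continuous_join h).comp (Continuous.prodMk continuous_snd ?_))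
      fun_prop
    · fun_prop
  exact measurable_measure_prodMk_left hmeas

theorem sliceRank_join (h : k ≤ n) (g : E n → ℝ) (y : E k) (z : E (n - k)) :
    sliceRank h g (join y z) = volume {y' : E k | g (join y' z) < g (join y z)} := by
  rw [sliceRank, joinEquiv_symm_join]
  rfl

/-- The squared modulus at which `v` is placed by the slicewise symmetric rearrangement. -/
def rankSq (h : k ≤ n) (g : E n → ℝ) (v : E n) : ℝ :=
  (((sliceRank h g v).toReal / (volume (Metric.ball (0 : E k) 1)).toReal) ^ ((k : ℝ)⁻¹)) ^ 2 +
    ‖((joinEquiv h).symm v).snd‖ ^ 2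

/-- The admissible kernel adapted to the slice sublevel sets of `g`. -/
def rankKernel (h : k ≤ n) (s : ℝ) (g : E n → ℝ) (v : E n) : ℝ≥0 :=
  Real.toNNReal (rankSq h g v ^ (-((n : ℝ) + 2 * s) / 2))

theorem rankSq_nonneg (h : k ≤ n) (g : E n → ℝ) (v : E n) : 0 ≤ rankSq h g v := by
  unfold rankSq; positivity

theorem measurable_rankKernel (h : k ≤ n) (s : ℝ) {g : E n → ℝ} (hg : Continuous g) :
    Measurable (rankKernel h s g) := by
  have h1 : Measurable (rankSq h g) := by
    have := (measurable_sliceRank h hg).ennreal_toReal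
    have h2 : Continuous fun v : E n => ‖((joinEquiv h).symm v).snd‖ ^ 2 := by fun_prop
    have h3 := h2.measurable
    unfold rankSq
    fun_prop
  unfold rankKernel
  fun_prop

theorem lt_rankKernel_iff (h : k ≤ n) {s : ℝ} (hs : 0 < s) (g : E n → ℝ) (v : E n) {r : ℝ}
    (hr : 0 < r) :
    r ^ (-(n : ℝ) - 2 * s) < (rankKernel h s g v : ℝ) ↔
      rankSq h g v ≠ 0 ∧ rankSq h g v < r ^ 2 := by
  have hnn := rankSq_nonneg h g v
  have hexp : -((n : ℝ) + 2 * s) / 2 < 0 := by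
    have : (0 : ℝ) ≤ n := Nat.cast_nonneg n
    linarith
  have hr2 : r ^ (-(n : ℝ) - 2 * s) = (r ^ 2) ^ (-((n : ℝ) + 2 * s) / 2) := by
    rw [← Real.rpow_natCast, ← Real.rpow_mul hr.le]
    congr 1
    push_cast
    ring
  rw [rankKernel, Real.coe_toNNReal _ (Real.rpow_nonneg hnn _), hr2]
  -- Since `0 ^ e = 0` for a nonzero real exponent, the kernel takes the value 0, not infinity,
  -- where `rankSq` vanishes; hence the first conjunct on the right.
  rcases hnn.eq_or_lt with h0 | hpos
  · rw [← h0, Real.zero_rpow hexp.ne]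
    simp only [ne_eq, not_true_eq_false, false_and, iff_false, not_lt]
    positivity
  · rw [Real.rpow_lt_rpow_iff_of_neg (by positivity) hpos hexp]
    simp [hpos.ne']

/-- The first summand of `rankSq` is ρ², where ρ is the radius of the ball in ℝᵏ whose volume is the
rank. So ρ² < r² - |z|² compares the rank with the volume of the ball slice. -/
theorem rankSq_join_lt_iff (h : k ≤ n) (hk : 1 ≤ k) (g : E n → ℝ) (y : E k) (z : E (n - k))
    {r : ℝ} (hr : 0 < r) (hfin : sliceRank h g (join y z) ≠ ∞) :
    rankSq h g (join y z) < r ^ 2 ↔ sliceRank h g (join y z) < ballSlice k r z := by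
  have hk' : (0 : ℝ) < k := by exact_mod_cast hk
  have : Nonempty (Fin k) := ⟨⟨0, hk⟩⟩
  have hω : 0 < (volume (Metric.ball (0 : E k) 1)).toReal :=
    ENNReal.toReal_pos (Metric.measure_ball_pos _ _ one_pos).ne' measure_ball_lt_top.ne
  rw [rankSq, joinEquiv_symm_join, ballSlice]
  change (((sliceRank h g (join y z)).toReal / _) ^ ((k : ℝ)⁻¹)) ^ 2 + ‖z‖ ^ 2 < r ^ 2 ↔ _
  set R := sliceRank h g (join y z)
  set ω := (volume (Metric.ball (0 : E k) 1)).toReal with hωdef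
  have hW : 0 ≤ (R.toReal / ω) ^ ((k : ℝ)⁻¹) := by positivity
  rw [← lt_sub_iff_add_lt]
  split_ifs with hz
  · rw [← Real.lt_sqrt hW, Measure.addHaar_ball _ _ (Real.sqrt_nonneg _),
      finrank_euclideanSpace_fin]
    set ρ := Real.sqrt (r ^ 2 - ‖z‖ ^ 2)
    have hρ : 0 ≤ ρ := Real.sqrt_nonneg _
    rw [Real.rpow_inv_lt_iff_of_pos (by positivity) hρ hk', Real.rpow_natCast, div_lt_iff₀ hω,
      ← ENNReal.ofReal_toReal (measure_ball_lt_top (x := (0 : E k)) (r := 1)).ne, ← hωdef,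
      ← ENNReal.ofReal_mul (by positivity), ENNReal.lt_ofReal_iff_toReal_lt hfin]
  · have : r ^ 2 ≤ ‖z‖ ^ 2 := pow_le_pow_left₀ hr.le (not_lt.1 hz) 2
    simp only [not_lt_zero, iff_false, not_lt]
    nlinarith [sq_nonneg ((R.toReal / ω) ^ ((k : ℝ)⁻¹))]

/-- The superlevel sets of the kernel adapted to `g` are slicewise sublevel sets of `g`. -/
theorem superlevel_rankKernel (h : k ≤ n) (hk : 1 ≤ k) {s : ℝ} (hs : 0 < s) {g : E n → ℝ}
    (hg : Continuous g) (z : E (n - k))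
    (hfin : ∀ t, volume {y : E k | g (join y z) ≤ t} ≠ ∞)
    (hnull : ∀ t, volume {y : E k | g (join y z) = t} = 0)
    (hbdd : ∃ b, ∀ y : E k, b ≤ g (join y z)) {r : ℝ} (hr : 0 < r) :
    (‖z‖ < r → ∃ t₀ : ℝ, {y : E k | r ^ (-(n : ℝ) - 2 * s) < (rankKernel h s g (join y z) : ℝ)}
        =ᵐ[volume] {y | g (join y z) < t₀}) ∧
      volume {y : E k | r ^ (-(n : ℝ) - 2 * s) < (rankKernel h s g (join y z) : ℝ)} =
        ballSlice k r z := by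
  have : Nonempty (Fin k) := ⟨⟨0, hk⟩⟩
  have hφ : Measurable fun y : E k => g (join y z) := hg.measurable.comp (measurable_join_left h z)
  have huniv : volume (Set.univ : Set (E k)) = ∞ :=
    measure_univ_of_isAddLeftInvariant _
  have key := fun {c : ℝ≥0∞} => exists_sublevel_ae_eq_rank_lt (c := c) hφ hfin hnull huniv hbdd
  have hrank : ∀ y, sliceRank h g (join y z) ≠ ∞ := fun y => by
    rw [sliceRank_join]
    exact ne_top_of_le_ne_top (hfin (g (join y z)))
      (measure_mono fun y' (hy' : g (join y' z) < g (join y z)) => hy'.le)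
  -- The points of rank zero lie in the set of rank less than `c`, of measure `c`, for every finite
  -- positive `c`. This removes the exceptional points where the kernel was set to 0.
  have hzero : volume {y : E k | sliceRank h g (join y z) = 0} = 0 := by
    by_contra hne
    have hlt : 0 < min (volume {y : E k | sliceRank h g (join y z) = 0}) 1 :=
      lt_min (pos_iff_ne_zero.2 hne) one_pos
    obtain ⟨c, hc0, hc⟩ := exists_between hlt
    obtain ⟨t₀, ht₀, hae⟩ := key hc0 (ne_top_of_lt (hc.trans_le (min_le_right _ _)))
    have h1 : volume {y : E k | sliceRank h g (join y z) = 0} ≤ c := by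
      rw [← ht₀, ← measure_congr hae]
      refine measure_mono fun y hy => ?_
      have hy' : sliceRank h g (join y z) = 0 := hy
      rw [sliceRank_join] at hy'
      have h2 : volume {y' : E k | g (join y' z) < g (join y z)} < c := by rw [hy']; exact hc0
      exact h2
    exact absurd h1 (not_le.2 (hc.trans_le (min_le_left _ _)))
  have hset : {y : E k | r ^ (-(n : ℝ) - 2 * s) < (rankKernel h s g (join y z) : ℝ)}
      =ᵐ[volume] {y | sliceRank h g (join y z) < ballSlice k r z} := by
    have hne : ∀ᵐ y : E k, sliceRank h g (join y z) ≠ 0 := by rw [ae_iff]; simpa using hzero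
    filter_upwards [hne] with y hy
    refine propext ((lt_rankKernel_iff h hs g (join y z) hr).trans ?_)
    rw [rankSq_join_lt_iff h hk g y z hr (hrank y)]
    refine ⟨fun h => h.2, fun h' => ⟨?_, h'⟩⟩
    have hR : 0 < (sliceRank h g (join y z)).toReal := ENNReal.toReal_pos hy (hrank y)
    have hω : 0 < (volume (Metric.ball (0 : E k) 1)).toReal :=
      ENNReal.toReal_pos (Metric.measure_ball_pos _ _ one_pos).ne' measure_ball_lt_top.ne
    rw [rankSq]
    positivity
  rw [measure_congr hset]
  by_cases hz : ‖z‖ < r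
  · have hpos : 0 < ballSlice k r z := by
      rw [ballSlice, if_pos hz]
      refine Metric.measure_ball_pos _ _ (Real.sqrt_pos.2 (sub_pos.2 ?_))
      gcongr
    obtain ⟨t₀, ht₀, hae⟩ := key hpos (ballSlice_ne_top r z)
    simp only [← sliceRank_join h] at hae
    exact ⟨fun _ => ⟨t₀, hset.trans hae⟩, by rw [measure_congr hae, ht₀]⟩
  · refine ⟨fun hz' => absurd hz' hz, ?_⟩
    simp [ballSlice, hz]

end

/-! ### Deviation of a convex C^{1,1} function, and the strictly convex perturbation. -/

section

variable {n : ℕ}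

/-- The infimum is attained: for each fixed pair of points, every Lipschitz constant dominates the
difference quotient, hence so does their infimum. -/
theorem lipschitzWith_c11Seminorm {u : E n → ℝ} (hu : IsC11 u) :
    LipschitzWith (c11Seminorm u) (gradient u) := by
  intro x y
  obtain ⟨-, L, hL⟩ := hu
  rw [edist_nndist, edist_nndist]
  norm_cast
  by_cases h0 : nndist x y = 0
  · have := hL x y
    rw [edist_nndist, edist_nndist] at this
    norm_cast at this
    simpa [h0] using this
  · rw [← div_le_iff₀ (pos_iff_ne_zero.2 h0)]
    refine le_csInf ⟨L, hL⟩ fun L' hL' => ?_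
    rw [div_le_iff₀ (pos_iff_ne_zero.2 h0)]
    have := hL' x y
    rw [edist_nndist, edist_nndist] at this
    exact_mod_cast this

theorem fderiv_eq_toDual_gradient {u : E n → ℝ} (x : E n) :
    fderiv ℝ u x = InnerProductSpace.toDual ℝ (E n) (gradient u x) := by
  simp [gradient]

theorem norm_fderiv_sub_le {u : E n → ℝ} (hu : IsC11 u) (x y : E n) :
    ‖fderiv ℝ u x - fderiv ℝ u y‖ ≤ c11Seminorm u * ‖x - y‖ := by
  rw [fderiv_eq_toDual_gradient, fderiv_eq_toDual_gradient, ← map_sub,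
    LinearIsometryEquiv.norm_map, ← dist_eq_norm, ← dist_eq_norm]
  exact (lipschitzWith_c11Seminorm hu).dist_le_mul x y

theorem dev_eq_fderiv (u : E n → ℝ) (x v : E n) :
    dev u x v = u (x + v) - u x - fderiv ℝ u x v := by
  rw [dev, fderiv_eq_toDual_gradient, InnerProductSpace.toDual_apply_apply, real_inner_comm]

theorem continuous_dev {u : E n → ℝ} (hu : Differentiable ℝ u) (x : E n) :
    Continuous (dev u x) := by
  have := hu.continuous
  unfold dev
  fun_prop

theorem dev_zero (u : E n → ℝ) (x : E n) : dev u x 0 = 0 := by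
  simp [dev]

theorem convexOn_dev {u : E n → ℝ} (hu : ConvexOn ℝ Set.univ u) (x : E n) :
    ConvexOn ℝ Set.univ (dev u x) := by
  refine ⟨convex_univ, fun v _ w _ a b ha hb hab => ?_⟩
  have h := hu.2 (Set.mem_univ (x + v)) (Set.mem_univ (x + w)) ha hb hab
  have h1 : a • (x + v) + b • (x + w) = x + (a • v + b • w) := by
    rw [smul_add, smul_add, add_add_add_comm, ← add_smul, hab, one_smul]
  rw [h1] at h
  simp only [dev_eq_fderiv, map_add, map_smul, smul_eq_mul] at h ⊢
  have h2 : u x = a * u x + b * u x := by rw [← add_mul, hab, one_mul]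
  linarith

/-- Mean value inequality for `u` minus its differential at `x`, on the ball of radius |v| about
`x`, where the derivative is at most L|v|. The sharper factor 1/2 is not needed. -/
theorem dev_le_sq {u : E n → ℝ} (hu : IsC11 u) (x v : E n) :
    dev u x v ≤ c11Seminorm u * ‖v‖ ^ 2 := by
  have hd : ∀ p : E n, HasFDerivAt (fun p => u p - fderiv ℝ u x p)
      (fderiv ℝ u p - fderiv ℝ u x) p := fun p =>
    (hu.1 p).hasFDerivAt.sub (fderiv ℝ u x).hasFDerivAt
  have h := (convex_closedBall x ‖v‖).norm_image_sub_le_of_norm_fderiv_le (𝕜 := ℝ)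
    (f := fun p => u p - fderiv ℝ u x p) (C := c11Seminorm u * ‖v‖) (x := x) (y := x + v)
    (fun p _ => (hd p).differentiableAt)
    (fun p hp => by
      rw [(hd p).fderiv]
      refine (norm_fderiv_sub_le hu p x).trans ?_
      gcongr
      simpa [dist_eq_norm] using hp)
    (by simp) (by simp)
  have h' := (le_abs_self _).trans h
  rw [add_sub_cancel_left, map_add] at h'
  rw [dev_eq_fderiv]
  nlinarith

/-- The increment p ↦ u(p + v) - u(p) has derivative at most L|v|, and the linear term changes by at
most L|x' - x||v|; this accounts for the factor 2. -/
theorem dev_le_dev_add {u : E n → ℝ} (hu : IsC11 u) (x x' v : E n) :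
    dev u x' v ≤ dev u x v + 2 * c11Seminorm u * ‖x' - x‖ * ‖v‖ := by
  have hd : ∀ p : E n, HasFDerivAt (fun p => u (p + v) - u p)
      (fderiv ℝ u (p + v) - fderiv ℝ u p) p := fun p =>
    ((hasFDerivAt_comp_add_right v).2 (hu.1 (p + v)).hasFDerivAt).sub (hu.1 p).hasFDerivAt
  have h := (convex_univ (𝕜 := ℝ) (E := E n)).norm_image_sub_le_of_norm_fderiv_le (𝕜 := ℝ)
    (f := fun p => u (p + v) - u p) (C := c11Seminorm u * ‖v‖) (x := x) (y := x')
    (fun p _ => (hd p).differentiableAt)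
    (fun p _ => by
      rw [(hd p).fderiv]
      simpa using norm_fderiv_sub_le hu (p + v) p)
    (Set.mem_univ _) (Set.mem_univ _)
  have h1 := (le_abs_self _).trans h
  have h2 : fderiv ℝ u x v - fderiv ℝ u x' v ≤ c11Seminorm u * ‖x' - x‖ * ‖v‖ := by
    refine (le_abs_self _).trans ?_
    rw [← sub_apply, ← Real.norm_eq_abs]
    refine (ContinuousLinearMap.le_opNorm _ _).trans ?_
    gcongr
    rw [norm_sub_rev x' x]
    exact norm_fderiv_sub_le hu x x'
  rw [dev_eq_fderiv, dev_eq_fderiv]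
  linarith

/-- Bounded sections force linear growth of `ũ_x`. -/
theorem norm_le_of_ediam_sect {u : E n → ℝ} (hu : ConvexOn ℝ Set.univ u) (hd : Differentiable ℝ u)
    {x : E n} {ε : ℝ} (hε : 0 < ε) {Λ : ℝ≥0} (hΛ : 0 < Λ)
    (hdiam : Metric.ediam (sect u x ε) ≤ Λ) (v : E n) :
    ‖v‖ ≤ 2 * Λ + 2 * Λ / ε * dev u x v := by
  have hfar : ∀ w : E n, (Λ : ℝ) < ‖w‖ → ε < dev u x w := by
    intro w hw
    by_contra! hle
    have h1 : x + w ∈ sect u x ε := by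
      have h2 : u (x + w) - u x - inner ℝ (x + w - x) (gradient u x) ≤ ε := by
        simpa [dev] using hle
      exact h2
    have h2 : x ∈ sect u x ε := by
      have h2 : u x - u x - inner ℝ (x - x) (gradient u x) ≤ ε := by simpa using hε.le
      exact h2
    have h3 := (Metric.edist_le_ediam_of_mem h1 h2).trans hdiam
    rw [edist_nndist] at h3
    have h4 : nndist (x + w) x ≤ Λ := by exact_mod_cast h3
    have h5 : dist (x + w) x ≤ Λ := h4
    rw [dist_eq_norm, add_sub_cancel_left] at h5
    linarith
  have hΛ' : (0 : ℝ) < Λ := hΛ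
  have hdev := dev_nonneg hu (hd x) v
  rcases le_or_gt ‖v‖ (2 * Λ) with hv | hv
  · have : 0 ≤ 2 * Λ / ε * dev u x v := by positivity
    linarith
  · have hv0 : 0 < ‖v‖ := by linarith
    -- The vector `v` is shrunk to length 2Λ, strictly outside the section. As the deviation is
    -- convex and vanishes at 0, it then grows at least linearly along the ray.
    set c : ℝ := 2 * Λ / ‖v‖ with hc
    have hc0 : 0 < c := by positivity
    have hc1 : c ≤ 1 := (div_le_one hv0).2 hv.le
    have h1 : ε < dev u x (c • v) := by
      refine hfar _ ?_
      rw [norm_smul, Real.norm_of_nonneg hc0.le, hc, div_mul_cancel₀ _ hv0.ne']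
      linarith
    have h2 := (convexOn_dev hu x).2 (Set.mem_univ v) (Set.mem_univ 0) hc0.le
      (sub_nonneg.2 hc1) (by ring)
    rw [smul_zero, add_zero, dev_zero, smul_zero, add_zero, smul_eq_mul] at h2
    have h3 : ε * ‖v‖ ≤ 2 * Λ * dev u x v := by
      have := (h1.trans_le h2).le
      rw [hc, div_mul_eq_mul_div, le_div_iff₀ hv0] at this
      exact this
    have h4 : ‖v‖ ≤ 2 * Λ / ε * dev u x v := by
      rw [div_mul_eq_mul_div, le_div_iff₀ hε]
      linarith
    linarith

/-- A strictly convex function, quadratic at the origin and linear at infinity. -/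
def bump (v : E n) : ℝ := Real.sqrt (1 + ‖v‖ ^ 2) - 1

theorem continuous_bump : Continuous (bump : E n → ℝ) := by
  unfold bump; fun_prop

theorem bump_nonneg (v : E n) : 0 ≤ bump v := by
  rw [bump, sub_nonneg, Real.one_le_sqrt]
  nlinarith [sq_nonneg ‖v‖]

theorem bump_le_norm (v : E n) : bump v ≤ ‖v‖ := by
  rw [bump, sub_le_iff_le_add, Real.sqrt_le_left (by positivity)]
  nlinarith [norm_nonneg v]

theorem bump_le_sq (v : E n) : bump v ≤ ‖v‖ ^ 2 := by
  rw [bump, sub_le_iff_le_add, Real.sqrt_le_left (by positivity)]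
  nlinarith [sq_nonneg ‖v‖, sq_nonneg (‖v‖ ^ 2)]

theorem norm_le_bump_add (v : E n) : ‖v‖ ≤ bump v + 1 := by
  rw [bump, sub_add_cancel]
  exact Real.le_sqrt_of_sq_le (by linarith)

theorem convexOn_bump : ConvexOn ℝ Set.univ (bump : E n → ℝ) := by
  -- Up to the constant 1, `bump` is the norm of (1, v), so convexity is the triangle inequality.
  have h : ∀ v : E n, bump v = ‖WithLp.toLp 2 ((1 : ℝ), v)‖ - 1 := fun v => by
    rw [WithLp.prod_norm_eq_of_L2, bump]; simp
  refine ⟨convex_univ, fun v _ w _ a b ha hb hab => ?_⟩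
  have h1 : WithLp.toLp 2 ((1 : ℝ), a • v + b • w) =
      a • WithLp.toLp 2 ((1 : ℝ), v) + b • WithLp.toLp 2 ((1 : ℝ), w) := by
    refine WithLp.ofLp_injective 2 (Prod.ext ?_ rfl)
    change (1 : ℝ) = a * 1 + b * 1
    linarith
  rw [h, h, h, h1]
  have h2 := norm_add_le (a • WithLp.toLp 2 ((1 : ℝ), v)) (b • WithLp.toLp 2 ((1 : ℝ), w))
  rw [norm_smul, norm_smul, Real.norm_of_nonneg ha, Real.norm_of_nonneg hb] at h2
  simp only [smul_eq_mul]
  linarith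

theorem two_mul_bump_lt (v w : E n) (hw : w ≠ 0) :
    2 * bump v < bump (v + w) + bump (v - w) := by
  have hw' : 0 < ‖w‖ := norm_pos_iff.2 hw
  have h1 := norm_add_sq_real v w
  have h2 := norm_sub_sq_real v w
  set c := inner ℝ v w
  have hcs : c ^ 2 ≤ ‖v‖ ^ 2 * ‖w‖ ^ 2 := by
    rw [← mul_pow]
    exact sq_le_sq' (by linarith [abs_le.1 (abs_real_inner_le_norm v w)])
      (real_inner_le_norm v w)
  have e1 := Real.sq_sqrt (show 0 ≤ 1 + ‖v‖ ^ 2 by positivity)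
  have e2 := Real.sq_sqrt (show 0 ≤ 1 + ‖v + w‖ ^ 2 by positivity)
  have e3 := Real.sq_sqrt (show 0 ≤ 1 + ‖v - w‖ ^ 2 by positivity)
  have p1 := Real.sqrt_nonneg (1 + ‖v‖ ^ 2)
  have p2 := Real.sqrt_nonneg (1 + ‖v + w‖ ^ 2)
  have p3 := Real.sqrt_nonneg (1 + ‖v - w‖ ^ 2)
  simp only [bump]
  set A := Real.sqrt (1 + ‖v‖ ^ 2)
  set B := Real.sqrt (1 + ‖v + w‖ ^ 2)
  set D := Real.sqrt (1 + ‖v - w‖ ^ 2)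
  -- By the parallelogram law B² + D² = 2A² + 2|w|², so 2A < B + D amounts to A² - |w|² < BD. By
  -- Cauchy–Schwarz, B²D² exceeds (A² - |w|²)² by at least 4|w|².
  have hprod : 1 + ‖v‖ ^ 2 - ‖w‖ ^ 2 < B * D := by
    refine lt_of_pow_lt_pow_left₀ 2 (by positivity) ?_
    rw [mul_pow, e2, e3, h1, h2]
    nlinarith [pow_pos hw' 2]
  have : 2 * A < B + D := by
    refine lt_of_pow_lt_pow_left₀ 2 (by positivity) ?_
    nlinarith
  linarith

end

/-! ### Integration of the error over the levels. -/

section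

/-- The error integral over the levels of the kernels. -/
theorem lintegral_min_le (n : ℕ) {s : ℝ} (hs : 0 < s) (hs1 : s < 1) {b q h : ℝ} (hb : 0 ≤ b)
    (hq : 0 ≤ q) (hh : 0 < h) :
    ∫⁻ l in Set.Ioi (0 : ℝ), ENNReal.ofReal
        (min b (q * (l ^ (-1 / ((n : ℝ) + 2 * s))) ^ 2) * (l ^ (-1 / ((n : ℝ) + 2 * s))) ^ n) ≤
      ENNReal.ofReal (b * (h ^ (-s) * (((n : ℝ) + 2 * s) / (2 * s))) +
        q * (h ^ (1 - s) * (((n : ℝ) + 2 * s) / (2 - 2 * s)))) := by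
  have hn : (0 : ℝ) ≤ n := Nat.cast_nonneg n
  set p : ℝ := (n : ℝ) + 2 * s with hp
  have hp0 : 0 < p := by positivity
  have h2s : 0 < 2 - 2 * s := by linarith
  -- The level at which r = l^(-1/p) equals √h, where r² reaches the size of h. Below it the
  -- constant `b` is used, integrable at 0 because s > 0; above it the quadratic term, integrable at
  -- infinity because s < 1.
  set l₀ : ℝ := h ^ (-p / 2)
  have hl₀ : 0 < l₀ := Real.rpow_pos_of_pos hh _
  have hpow : ∀ l : ℝ, 0 < l → ∀ m : ℕ, (l ^ (-1 / p)) ^ m = l ^ (-(m : ℝ) / p) := fun l hl m => by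
    rw [← Real.rpow_natCast, ← Real.rpow_mul hl.le]
    congr 1
    ring
  have hnear : ∫⁻ l in Set.Ioc 0 l₀, ENNReal.ofReal
      (min b (q * (l ^ (-1 / p)) ^ 2) * (l ^ (-1 / p)) ^ n) ≤
        ENNReal.ofReal (b * (h ^ (-s) * (p / (2 * s)))) := by
    have he : -1 < -(n : ℝ) / p := by rw [lt_div_iff₀ hp0]; linarith
    have hint : IntegrableOn (fun l : ℝ => b * l ^ (-(n : ℝ) / p)) (Set.Ioc 0 l₀) :=
      ((intervalIntegrable_iff_integrableOn_Ioc_of_le hl₀.le).1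
        (intervalIntegral.intervalIntegrable_rpow' he)).const_mul b
    have hval : ∫ l in Set.Ioc 0 l₀, b * l ^ (-(n : ℝ) / p) = b * (h ^ (-s) * (p / (2 * s))) := by
      rw [integral_const_mul, ← intervalIntegral.integral_of_le hl₀.le, integral_rpow (Or.inl he)]
      have h1 : -(n : ℝ) / p + 1 = 2 * s / p := by rw [hp]; field_simp; ring
      have h2 : l₀ ^ (2 * s / p) = h ^ (-s) := by
        rw [← Real.rpow_mul hh.le]
        congr 1
        field_simp
      rw [h1, h2, Real.zero_rpow (by positivity), sub_zero, div_eq_mul_inv, inv_div]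
    rw [← hval, ofReal_integral_eq_lintegral_ofReal hint]
    · refine setLIntegral_mono' measurableSet_Ioc fun l hl => ENNReal.ofReal_le_ofReal ?_
      rw [hpow l hl.1 n]
      exact mul_le_mul_of_nonneg_right (min_le_left _ _) (Real.rpow_nonneg hl.1.le _)
    · refine (ae_restrict_iff' measurableSet_Ioc).2 (Filter.Eventually.of_forall fun l hl => ?_)
      exact mul_nonneg hb (Real.rpow_nonneg hl.1.le _)
  have hfar : ∫⁻ l in Set.Ioi l₀, ENNReal.ofReal
      (min b (q * (l ^ (-1 / p)) ^ 2) * (l ^ (-1 / p)) ^ n) ≤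
        ENNReal.ofReal (q * (h ^ (1 - s) * (p / (2 - 2 * s)))) := by
    have he : -((n + 2 : ℕ) : ℝ) / p < -1 := by
      rw [div_lt_iff₀ hp0]; push_cast; linarith
    have hint : IntegrableOn (fun l : ℝ => q * l ^ (-((n + 2 : ℕ) : ℝ) / p)) (Set.Ioi l₀) :=
      (integrableOn_Ioi_rpow_of_lt he hl₀).const_mul q
    have hval : ∫ l in Set.Ioi l₀, q * l ^ (-((n + 2 : ℕ) : ℝ) / p) =
        q * (h ^ (1 - s) * (p / (2 - 2 * s))) := by
      rw [integral_const_mul, integral_Ioi_rpow_of_lt he hl₀]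
      have h1 : -((n + 2 : ℕ) : ℝ) / p + 1 = -((2 - 2 * s) / p) := by
        rw [hp]; push_cast; field_simp; ring
      have h2 : l₀ ^ (-((2 - 2 * s) / p)) = h ^ (1 - s) := by
        rw [← Real.rpow_mul hh.le]
        congr 1
        field_simp
      rw [h1, h2, neg_div_neg_eq, div_eq_mul_inv, inv_div]
    rw [← hval, ofReal_integral_eq_lintegral_ofReal hint]
    · refine setLIntegral_mono' measurableSet_Ioi fun l hl => ENNReal.ofReal_le_ofReal ?_
      have hl' : 0 < l := hl₀.trans hl
      rw [← hpow l hl' (n + 2), pow_add, mul_comm ((l ^ (-1 / p)) ^ n), ← mul_assoc]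
      exact mul_le_mul_of_nonneg_right (min_le_right _ _)
        (pow_nonneg (Real.rpow_nonneg hl'.le _) _)
    · refine (ae_restrict_iff' measurableSet_Ioi).2 (Filter.Eventually.of_forall fun l hl => ?_)
      exact mul_nonneg hq (Real.rpow_nonneg (hl₀.trans hl).le _)
  rw [← Set.Ioc_union_Ioi_eq_Ioi hl₀.le, ENNReal.ofReal_add (by positivity) (by positivity)]
  exact (lintegral_union_le _ _ _).trans (add_le_add hnear hfar)

end

/-! ### The optimal kernel against an arbitrary admissible one. -/

section

variable {n k : ℕ}

theorem volume_slice_superlevel {s : ℝ} (hs : 0 < s) {K : E n → ℝ≥0} (hK : K ∈ kernels n k s)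
    {l : ℝ} (hl : 0 < l) (z : E (n - k)) :
    volume {y : E k | join y z ∈ {v | l < (K v : ℝ)}} =
      ballSlice k (l ^ (-1 / ((n : ℝ) + 2 * s))) z := by
  have h := hK.2 z (l ^ (-1 / ((n : ℝ) + 2 * s))) (Real.rpow_pos_of_pos hl _)
  have hp : (n : ℝ) + 2 * s ≠ 0 := by positivity
  have h1 : -1 / ((n : ℝ) + 2 * s) * (-(n : ℝ) - 2 * s) = 1 := by field_simp; ring
  rw [← Real.rpow_mul hl.le, h1, Real.rpow_one] at h
  exact h

/-- The kernel adapted to `g` is, up to the error integral, at least as good for `g` as any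
admissible kernel for `f`, if `g ≤ a f + b` and `g ≤ q |v|²`. -/
theorem exists_kernel_le (hk : 1 ≤ k) (hkn : k ≤ n) {s : ℝ} (hs : 0 < s) {f g : E n → ℝ}
    (hf : Measurable f) (hg : Continuous g)
    (hfin : ∀ (z : E (n - k)) t, volume {y : E k | g (join y z) ≤ t} ≠ ∞)
    (hnull : ∀ (z : E (n - k)) t, volume {y : E k | g (join y z) = t} = 0)
    (hbdd : ∃ b, ∀ v, b ≤ g v) {a b q : ℝ} (ha : 0 ≤ a) (hb : 0 ≤ b) (hq : 0 ≤ q)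
    (hgf : ∀ v, g v ≤ a * f v + b) (hgq : ∀ v, g v ≤ q * ‖v‖ ^ 2) :
    ∃ K' ∈ kernels n k s, ∀ K ∈ kernels n k s,
      ∫⁻ v, ENNReal.ofReal (g v) * (K' v : ℝ≥0∞) ≤
        ENNReal.ofReal a * (∫⁻ v, ENNReal.ofReal (f v) * (K v : ℝ≥0∞)) +
        (∫⁻ l in Set.Ioi (0 : ℝ), ENNReal.ofReal
        (min b (q * (l ^ (-1 / ((n : ℝ) + 2 * s))) ^ 2) * (l ^ (-1 / ((n : ℝ) + 2 * s))) ^ n)) *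
          volume (Metric.ball (0 : E n) 1) := by
  have hp : (n : ℝ) + 2 * s ≠ 0 := by positivity
  obtain ⟨m, hm⟩ := hbdd
  have hsup := fun (z : E (n - k)) {r : ℝ} (hr : 0 < r) =>
    superlevel_rankKernel hkn hk hs hg z (hfin z) (hnull z) ⟨m, fun y => hm _⟩ hr
  have hK' : rankKernel hkn s g ∈ kernels n k s :=
    ⟨measurable_rankKernel hkn s hg, fun z r hr => (hsup z hr).2⟩
  refine ⟨_, hK', fun K hK => ?_⟩
  have : Nonempty (Fin n) := ⟨⟨0, by omega⟩⟩
  rw [lintegral_mul_eq_lintegral_superlevel (by fun_prop) hK'.1,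
    lintegral_mul_eq_lintegral_superlevel (by fun_prop) hK.1,
    ← lintegral_const_mul' _ _ ENNReal.ofReal_ne_top,
    ← lintegral_mul_const' _ _ measure_ball_lt_top.ne,
    ← lintegral_add_right _ (by fun_prop)]
  refine setLIntegral_mono' measurableSet_Ioi fun l hl => ?_
  have hl0 : 0 < l := hl
  set r : ℝ := l ^ (-1 / ((n : ℝ) + 2 * s)) with hr_def
  have hr : 0 < r := Real.rpow_pos_of_pos hl0 _
  have hrl : r ^ (-(n : ℝ) - 2 * s) = l := by
    have h1 : -1 / ((n : ℝ) + 2 * s) * (-(n : ℝ) - 2 * s) = 1 := by field_simp; ring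
    rw [hr_def, ← Real.rpow_mul hl0.le, h1, Real.rpow_one]
  set A : Set (E n) := {v | l < (K v : ℝ)}
  set B : Set (E n) := {v | l < (rankKernel hkn s g v : ℝ)}
  have hA : MeasurableSet A := measurableSet_lt measurable_const hK.1.coe_nnreal_real
  have hB : MeasurableSet B := measurableSet_lt measurable_const hK'.1.coe_nnreal_real
  have hsA := volume_slice_superlevel hs hK hl0
  have hsB := volume_slice_superlevel hs hK' hl0
  have hsub : ∀ z : E (n - k), ‖z‖ < r → ∃ t₀ : ℝ,
      {y : E k | join y z ∈ B} =ᵐ[volume] {y | g (join y z) < t₀} := fun z hz => by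
    have h := (hsup z hr).1 hz
    rw [hrl] at h
    exact h
  have hball : volume (Metric.ball (0 : E n) r) =
      ENNReal.ofReal (r ^ n) * volume (Metric.ball (0 : E n) 1) := by
    rw [Measure.addHaar_ball _ _ hr.le, finrank_euclideanSpace_fin]
  have hvolA : volume A = volume (Metric.ball (0 : E n) r) := volume_eq_of_slices hkn hA hr hsA
  -- First competitor: the superlevel set of `K`, where `g` is bounded through `f`.
  have h1 : ∫⁻ v in B, ENNReal.ofReal (g v) ≤
      ENNReal.ofReal a * (∫⁻ v in A, ENNReal.ofReal (f v)) +
        ENNReal.ofReal b * volume (Metric.ball (0 : E n) r) := by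
    refine (setLIntegral_le_of_slices hkn hA hB hg.measurable hsA hsB hsub).trans ?_
    rw [← hvolA, ← setLIntegral_const, ← lintegral_const_mul' _ _ ENNReal.ofReal_ne_top,
      ← lintegral_add_right _ measurable_const]
    refine lintegral_mono fun v => ?_
    rw [← ENNReal.ofReal_mul ha]
    exact (ENNReal.ofReal_le_ofReal (hgf v)).trans ENNReal.ofReal_add_le
  -- Second competitor: the ball of radius r, which has the same slice measures and on which `g` is
  -- at most q r².
  have h2 : ∫⁻ v in B, ENNReal.ofReal (g v) ≤
      ENNReal.ofReal (q * r ^ 2) * volume (Metric.ball (0 : E n) r) := by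
    refine (setLIntegral_le_of_slices hkn measurableSet_ball hB hg.measurable
      (volume_slice_ball hkn hr) hsB hsub).trans ?_
    rw [← setLIntegral_const]
    refine setLIntegral_mono' measurableSet_ball fun v hv => ENNReal.ofReal_le_ofReal ?_
    refine (hgq v).trans ?_
    gcongr
    exact (mem_ball_zero_iff.1 hv).le
  rw [ENNReal.ofReal_mul (le_min hb (by positivity)), mul_assoc, ← hball]
  rcases min_choice b (q * r ^ 2) with h | h
  · rw [h]; exact h1
  · rw [h]; exact h2.trans le_add_self

end

/-! ### The estimate between two points and the Hölder bound. -/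

section

variable {n k : ℕ}

/-- Comparison of `𝓕ₖˢ u` at two points. -/
theorem F_le_mul_F_add (hk : 1 ≤ k) (hkn : k < n) {s : ℝ} (hs : 0 < s)
    {u : E n → ℝ} (hu : ConvexOn ℝ Set.univ u) (hu' : IsC11 u) {x x' : E n} (hne : x ≠ x')
    {ε : ℝ} (hε : 0 < ε) {Λ : ℝ≥0} (hΛ : 0 < Λ) (hdiam : Metric.ediam (sect u x ε) ≤ Λ)
    (hL : 0 < c11Seminorm u) :
    F k s u x' ≤ ENNReal.ofReal (1 + 6 * c11Seminorm u * dist x' x * Λ / ε) * F k s u x +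
      ENNReal.ofReal (cns n s) *
        ((∫⁻ l in Set.Ioi (0 : ℝ), ENNReal.ofReal
          (min (6 * Λ * c11Seminorm u * dist x' x)
            (c11Seminorm u * (1 + dist x' x) * (l ^ (-1 / ((n : ℝ) + 2 * s))) ^ 2) *
              (l ^ (-1 / ((n : ℝ) + 2 * s))) ^ n)) * volume (Metric.ball (0 : E n) 1)) := by
  set L : ℝ≥0 := c11Seminorm u with hLdef
  set h : ℝ := dist x' x with hh
  have hh0 : 0 < h := dist_pos.2 hne.symm
  have hL0 : (0 : ℝ) < L := hL
  have hΛ0 : (0 : ℝ) < Λ := hΛ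
  have hδ : 0 < (L : ℝ) * h := by positivity
  have hdev := fun v => dev_nonneg hu (hu'.1 x) v
  have hdev' := fun v => dev_nonneg hu (hu'.1 x') v
  -- No section at `x'` is assumed bounded and u need not be strictly convex; `bump` supplies both
  -- bounded sublevel sets and null level sets in the slices. Its weight Lh keeps it within the
  -- order of the error.
  set g : E n → ℝ := fun v => dev u x' v + L * h * bump v with hg_def
  have hg : Continuous g := by
    have h1 := continuous_dev hu'.1 x'
    have h2 := continuous_bump (n := n)
    fun_prop
  have hgbump : ∀ v, L * h * bump v ≤ g v := fun v => by
    have := hdev' v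
    simp only [hg_def]; linarith
  have hdg : ∀ v, dev u x' v ≤ g v := fun v => by
    have := mul_nonneg hδ.le (bump_nonneg v)
    simp only [hg_def]; linarith
  have hfin : ∀ (z : E (n - k)) t, volume {y : E k | g (join y z) ≤ t} ≠ ∞ := fun z t => by
    refine ne_top_of_le_ne_top (measure_closedBall_lt_top (x := (0 : E k))
      (r := t / (L * h) + 1)).ne (measure_mono fun y hy => ?_)
    rw [mem_closedBall_zero_iff]
    have hy' : g (join y z) ≤ t := hy
    have h1 : bump (join y z) ≤ t / (L * h) := by
      rw [le_div_iff₀ hδ]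
      linarith [hgbump (join y z)]
    have h2 : ‖y‖ ≤ ‖join y z‖ := by
      refine (sq_le_sq₀ (norm_nonneg _) (norm_nonneg _)).1 ?_
      rw [norm_join_sq hkn.le]
      nlinarith [sq_nonneg ‖z‖]
    linarith [norm_le_bump_add (join y z)]
  have hgconv : ConvexOn ℝ Set.univ g :=
    (convexOn_dev hu x').add (convexOn_bump.smul hδ.le)
  have hnull : ∀ (z : E (n - k)) t, volume {y : E k | g (join y z) = t} = 0 := fun z t => by
    have : Nonempty (Fin k) := ⟨⟨0, hk⟩⟩
    refine measure_level_eq_zero volume (φ := fun y : E k => g (join y z)) ?_ ?_ t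
    · refine ⟨convex_univ, fun y _ y' _ a b ha hb hab => ?_⟩
      have h1 := hgconv.2 (Set.mem_univ (join y z)) (Set.mem_univ (join y' z)) ha hb hab
      rwa [← join_smul, ← join_smul, ← join_add, ← add_smul, hab, one_smul] at h1
    · intro y w hw
      have h0 : join w (0 : E (n - k)) ≠ 0 := by
        rw [← norm_ne_zero_iff, ← sq_pos_iff, norm_join_sq hkn.le]
        have := norm_pos_iff.2 hw
        positivity
      have h1 : join (y + w) z = join y z + join w 0 := by rw [← join_add, add_zero]
      have h2 : join (y - w) z = join y z - join w 0 := by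
        rw [eq_sub_iff_add_eq, ← join_add, sub_add_cancel, add_zero]
      have h3 := two_mul_bump_lt (join y z) (join w 0) h0
      have h4 := (convexOn_dev hu x').2 (Set.mem_univ (join y z + join w 0))
        (Set.mem_univ (join y z - join w 0)) (one_half_pos (α := ℝ)).le one_half_pos.le
        (add_halves 1)
      have h5 : (1 / 2 : ℝ) • (join y z + join w 0) + (1 / 2 : ℝ) • (join y z - join w 0) =
          join y z := by
        module
      rw [h5, smul_eq_mul, smul_eq_mul] at h4
      simp only [hg_def, h1, h2]
      nlinarith
  have hgf : ∀ v, g v ≤ (1 + 6 * L * h * Λ / ε) * dev u x v + 6 * Λ * L * h := fun v => by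
    have h1 := dev_le_dev_add hu' x x' v
    rw [← dist_eq_norm, ← hh, ← hLdef] at h1
    have h2 := mul_le_mul_of_nonneg_left (bump_le_norm v) hδ.le
    -- The factor 3 is 2 from the change of base point plus 1 from `bump v ≤ ‖v‖`.
    have h3 := mul_le_mul_of_nonneg_left
      (norm_le_of_ediam_sect hu hu'.1 hε hΛ hdiam v) (mul_nonneg zero_le_three hδ.le)
    have h4 : 3 * ((L : ℝ) * h) * (2 * Λ + 2 * Λ / ε * dev u x v) =
        6 * L * h * Λ / ε * dev u x v + 6 * Λ * L * h := by ring
    simp only [hg_def]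
    linarith
  have hgq : ∀ v, g v ≤ L * (1 + h) * ‖v‖ ^ 2 := fun v => by
    have h1 := dev_le_sq hu' x' v
    have h2 := mul_le_mul_of_nonneg_left (bump_le_sq v) hδ.le
    simp only [hg_def]
    linarith
  obtain ⟨K', hK', hle⟩ := exists_kernel_le hk hkn.le hs (continuous_dev hu'.1 x).measurable hg
    hfin hnull ⟨0, fun v => (hdev' v).trans (hdg v)⟩ (by positivity) (by positivity)
    (by positivity) hgf hgq
  have hpos : ENNReal.ofReal (1 + 6 * L * h * Λ / ε) ≠ 0 :=
    (ENNReal.ofReal_pos.2 (by positivity)).ne'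
  simp only [F]
  rw [mul_left_comm, ← mul_add]
  gcongr
  simp only [ENNReal.mul_iInf_of_ne hpos ENNReal.ofReal_ne_top, ENNReal.iInf_add]
  refine le_iInf₂ fun K hK => le_trans ?_ (hle K hK)
  refine (iInf₂_le K' hK').trans (lintegral_mono fun v => ?_)
  gcongr
  exact hdg v

/-- The Hölder constant. -/
def holderConst (n : ℕ) (s ε : ℝ) (Λ M : ℝ≥0) : ℝ≥0 :=
  -- Passing through `ENNReal.ofReal` avoids determining the sign of `cns n s`; the final 1 makes
  -- the constant positive even if the other terms vanish.
  Real.toNNReal (6 * Λ / ε * (2 * Λ) ^ s * M + (ENNReal.ofReal (cns n s)).toReal *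
    ((6 * Λ * (((n : ℝ) + 2 * s) / (2 * s)) + (1 + 2 * Λ) * (((n : ℝ) + 2 * s) / (2 - 2 * s))) *
      (volume (Metric.ball (0 : E n) 1)).toReal) + 1)

theorem holderConst_pos {n : ℕ} {s ε : ℝ} (hs : 0 < s) (hs1 : s < 1) (hε : 0 < ε) (Λ M : ℝ≥0) :
    0 < holderConst n s ε Λ M := by
  have : 0 < 2 - 2 * s := by linarith
  rw [holderConst, Real.toNNReal_pos]
  positivity

theorem toReal_F_le (hk : 1 ≤ k) (hkn : k < n) {s : ℝ} (hs : 0 < s) (hs1 : s < 1)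
    {u : E n → ℝ} (hu : ConvexOn ℝ Set.univ u) (hu' : IsC11 u) {x x' : E n} (hne : x ≠ x')
    {ε : ℝ} (hε : 0 < ε) {Λ M : ℝ≥0} (hΛ : 0 < Λ) (hdiam : Metric.ediam (sect u x ε) ≤ Λ)
    (hL : 0 < c11Seminorm u) (hM : F k s u x ≤ M) (hdist : dist x' x ≤ 2 * Λ) :
    (F k s u x').toReal ≤ (F k s u x).toReal +
      holderConst n s ε Λ M * c11Seminorm u * dist x' x ^ (1 - s) := by
  have hΛ0 : (0 : ℝ) < Λ := hΛ
  have hL0 : (0 : ℝ) < c11Seminorm u := hL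
  have h2s : 0 < 2 - 2 * s := by linarith
  have hmain := F_le_mul_F_add hk hkn hs hu hu' hne hε hΛ hdiam hL
  set L : ℝ≥0 := c11Seminorm u
  set h : ℝ := dist x' x
  have hh0 : 0 < h := dist_pos.2 hne.symm
  have hint := lintegral_min_le n hs hs1 (b := 6 * Λ * L * h) (q := L * (1 + h)) (by positivity)
    (by positivity) hh0
  set P₁ : ℝ := ((n : ℝ) + 2 * s) / (2 * s)
  set P₂ : ℝ := ((n : ℝ) + 2 * s) / (2 - 2 * s)
  have hP₁ : 0 ≤ P₁ := by positivity
  have hP₂ : 0 ≤ P₂ := by positivity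
  set I := 6 * Λ * L * h * (h ^ (-s) * P₁) + L * (1 + h) * (h ^ (1 - s) * P₂) with hI
  have hI0 : 0 ≤ I := by positivity
  have hω : volume (Metric.ball (0 : E n) 1) ≠ ∞ := measure_ball_lt_top.ne
  have hFx : F k s u x ≠ ∞ := ne_top_of_le_ne_top ENNReal.coe_ne_top hM
  have hle := hmain.trans (add_le_add le_rfl (mul_le_mul le_rfl
    (mul_le_mul hint le_rfl zero_le zero_le) zero_le zero_le))
  have hreal := ENNReal.toReal_mono (ENNReal.add_ne_top.2
    ⟨ENNReal.mul_ne_top ENNReal.ofReal_ne_top hFx, ENNReal.mul_ne_top ENNReal.ofReal_ne_top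
      (ENNReal.mul_ne_top ENNReal.ofReal_ne_top hω)⟩) hle
  rw [ENNReal.toReal_add (ENNReal.mul_ne_top ENNReal.ofReal_ne_top hFx)
    (ENNReal.mul_ne_top ENNReal.ofReal_ne_top (ENNReal.mul_ne_top ENNReal.ofReal_ne_top hω)),
    ENNReal.toReal_mul, ENNReal.toReal_mul, ENNReal.toReal_mul,
    ENNReal.toReal_ofReal (show 0 ≤ 1 + 6 * L * h * Λ / ε by positivity),
    ENNReal.toReal_ofReal hI0] at hreal
  have hMx : (F k s u x).toReal ≤ M := ENNReal.toReal_le_coe_of_le_coe hM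
  have hpow : h ^ (-s) * h = h ^ (1 - s) := by
    rw [← Real.rpow_add_one hh0.ne', neg_add_eq_sub]
  -- The multiplicative error is linear in h; the bound h ≤ 2Λ converts it to the Hölder power, and
  -- `M` bounds the factor F.
  have hlin : h ≤ (2 * Λ) ^ s * h ^ (1 - s) := by
    calc h = h ^ s * h ^ (1 - s) := by rw [← Real.rpow_add hh0]; simp
      _ ≤ (2 * Λ) ^ s * h ^ (1 - s) := by gcongr
  have hIle : I ≤ (6 * Λ * P₁ + (1 + 2 * Λ) * P₂) * (L * h ^ (1 - s)) := by
    have h1 : I = 6 * Λ * P₁ * (L * h ^ (1 - s)) + (1 + h) * (P₂ * (L * h ^ (1 - s))) := by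
      rw [hI, ← hpow]; ring
    rw [h1, add_mul (6 * Λ * P₁), mul_assoc (1 + 2 * (Λ : ℝ))]
    gcongr
  rw [holderConst, Real.coe_toNNReal _ (by positivity)]
  set c := (ENNReal.ofReal (cns n s)).toReal
  set ω := (volume (Metric.ball (0 : E n) 1)).toReal
  set T := L * h ^ (1 - s) with hT
  have hT0 : 0 ≤ T := by positivity
  have hfirst : 6 * L * h * Λ / ε * (F k s u x).toReal ≤ 6 * Λ / ε * (2 * Λ) ^ s * M * T := by
    calc 6 * L * h * Λ / ε * (F k s u x).toReal
        = 6 * Λ / ε * L * h * (F k s u x).toReal := by ring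
      _ ≤ 6 * Λ / ε * L * ((2 * Λ) ^ s * h ^ (1 - s)) * M := by gcongr
      _ = _ := by rw [hT]; ring
  have hsecond : c * (I * ω) ≤ c * ((6 * Λ * P₁ + (1 + 2 * Λ) * P₂) * T * ω) := by
    gcongr
  rw [mul_assoc _ (L : ℝ), ← hT]
  nlinarith

/-- With seminorm zero the deviation is nonpositive, so linear growth would confine every vector to
length 2Λ; one of length 3Λ contradicts this. Positivity is what gives the perturbation by `bump` a
nonzero weight. -/
theorem c11Seminorm_pos (hn : 0 < n) {u : E n → ℝ} (hu : ConvexOn ℝ Set.univ u) (hu' : IsC11 u)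
    {x : E n} {ε : ℝ} (hε : 0 < ε) {Λ : ℝ≥0} (hΛ : 0 < Λ)
    (hdiam : Metric.ediam (sect u x ε) ≤ Λ) : 0 < c11Seminorm u := by
  by_contra h
  have h0 : c11Seminorm u = 0 := by simpa using h
  have : Nonempty (Fin n) := ⟨⟨0, hn⟩⟩
  obtain ⟨v, hv⟩ := exists_norm_eq (E n) (c := 3 * (Λ : ℝ)) (by positivity)
  have hΛ0 : (0 : ℝ) < Λ := hΛ
  have h1 := dev_le_sq hu' x v
  rw [h0, NNReal.coe_zero, zero_mul] at h1
  have h2 := norm_le_of_ediam_sect hu hu'.1 hε hΛ hdiam v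
  have h3 : 2 * Λ / ε * dev u x v ≤ 0 := mul_nonpos_of_nonneg_of_nonpos (by positivity) h1
  linarith

end

end FracMA

end

theorem theorem5p1 (n k : ℕ) (hk : 1 ≤ k) (hkn : k < n) (s : ℝ) (hs : 1 / 2 < s) (hs1 : s < 1)
    (ε : ℝ) (hε : 0 < ε) (Λ M : ℝ≥0) :
    ∃ C₀ : ℝ≥0, 0 < C₀ ∧
      ∀ u : FracMA.E n → ℝ, ConvexOn ℝ Set.univ u → FracMA.IsC11 u →
      ∀ (x₀ : FracMA.E n) (r₀ : ℝ), 0 < r₀ →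
        (⨆ x ∈ Metric.ball x₀ r₀, Metric.ediam (FracMA.sect u x ε)) = (Λ : ℝ≥0∞) →
        (⨆ x ∈ Metric.ball x₀ r₀, FracMA.F k s u x) = (M : ℝ≥0∞) →
        ∀ r : ℝ, 0 < r → r < min (r₀ / 4) (min (Λ : ℝ) (ε / (8 * (Λ : ℝ)))) →
          (∀ x ∈ Metric.closedBall x₀ r, FracMA.F k s u x ≠ ∞) ∧
          HolderOnWith (C₀ * FracMA.c11Seminorm u) (Real.toNNReal (1 - s))
            (fun x => (FracMA.F k s u x).toReal) (Metric.closedBall x₀ r) := by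
  have hs0 : 0 < s := by linarith
  refine ⟨FracMA.holderConst n s ε Λ M, FracMA.holderConst_pos hs0 hs1 hε Λ M, ?_⟩
  intro u hu hu' x₀ r₀ hr₀ hdiam hF r hr hrlt
  obtain ⟨hr1, hr2⟩ := lt_min_iff.1 hrlt
  have hrΛ : r < Λ := (lt_min_iff.1 hr2).1
  have hΛ : 0 < Λ := NNReal.coe_pos.1 (hr.trans hrΛ)
  have hmem : ∀ x ∈ Metric.closedBall x₀ r, x ∈ Metric.ball x₀ r₀ := fun x hx =>
    Metric.closedBall_subset_ball (by linarith) hx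
  have hM : ∀ x ∈ Metric.closedBall x₀ r, FracMA.F k s u x ≤ M := fun x hx =>
    hF ▸ le_iSup₂ (f := fun x _ => FracMA.F k s u x) x (hmem x hx)
  have hD : ∀ x ∈ Metric.closedBall x₀ r, Metric.ediam (FracMA.sect u x ε) ≤ Λ := fun x hx =>
    hdiam ▸ le_iSup₂ (f := fun x _ => Metric.ediam (FracMA.sect u x ε)) x (hmem x hx)
  have hL : 0 < FracMA.c11Seminorm u :=
    FracMA.c11Seminorm_pos (by omega) hu hu' hε hΛ (hD x₀ (Metric.mem_closedBall_self hr.le))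
  refine ⟨fun x hx => ne_top_of_le_ne_top ENNReal.coe_ne_top (hM x hx), fun x hx x' hx' => ?_⟩
  rcases eq_or_ne x x' with rfl | hne
  · simp
  have hdist : dist x x' ≤ 2 * Λ := by
    have := dist_triangle_right x x' x₀
    have h1 := Metric.mem_closedBall.1 hx
    have h2 := Metric.mem_closedBall.1 hx'
    linarith
  -- The one-sided estimate needs the section and the bound on F only at its base point, and both
  -- points of the closed ball qualify.
  have h1 := FracMA.toReal_F_le hk hkn hs0 hs1 hu hu' hne.symm hε hΛ (hD x' hx') hL
    (hM x' hx') hdist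
  have h2 := FracMA.toReal_F_le hk hkn hs0 hs1 hu hu' hne hε hΛ (hD x hx) hL
    (hM x hx) (dist_comm x x' ▸ hdist)
  rw [dist_comm x' x] at h2
  rw [edist_dist, edist_dist, Real.coe_toNNReal _ (by linarith),
    ENNReal.ofReal_rpow_of_nonneg dist_nonneg (by linarith), ← ENNReal.ofReal_coe_nnreal,
    ← ENNReal.ofReal_mul (NNReal.coe_nonneg _)]
  refine ENNReal.ofReal_le_ofReal ?_
  rw [NNReal.coe_mul, Real.dist_eq, abs_le]
  constructor <;> linarith
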